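/- **Proposition ($C^0$-bound).** Let $M$ be a closed connected smooth Riemannian manifold, let $\nabla$ be its Levi-Civita connection and $S^1=\mathbb{R}/\mathbb{Z}$. Use $\nabla$ to split $T_{(x,y)}TM\cong T_xM\oplus T_xM$, $\dot z\mapsto(\dot x,\nabla_t y)$ for curves $z=(x,y)$ in $TM$, and let $\nabla H=(\nabla_1H,\nabla_2H)$ denote the gradient of a function $H$ on $TM$ with respect to the metric $\langle\xi,\xi'\rangle+\langle\eta,\eta'\rangle$ on $T_xM\oplus T_xM$. Let $r,c\ge 0$ and let $f_s:[r,\infty)\to\mathbb{R}$, $s\in\mathbb{R}$, be a family of smooth functions whose dependence on $s$ is of class $C^1$ (that is, for every $k\ge0$ the derivative $f_s^{(k)}(\rho)$ is a $C^1$ function of $(s,\rho)\in\mathbb{R}\times[r,\infty)$), such that $\partial_s f_s'\ge 0$ on $[r,\infty)$ for all $s$, and such that either $f_s''\ge -c$ on $[r,\infty)$ for all $s$, or $f_s''\le c$ on $[r,\infty)$ for all $s$. Let $H\in C^\infty(\mathbb{R}\times S^1\times TM)$ satisfy $$|y|\ge r\quad\Longrightarrow\quad H(s,t,x,y)=f_s(|y|).$$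 Let $(u,v)\in C^\infty(\mathbb{R}\times S^1,TM)$, with $v(s,t)\in T_{u(s,t)}M$, be a solution of $$\partial_s u-\nabla_t v=\nabla_1H(s,t,u,v),\qquad \nabla_s v+\partial_t u=\nabla_2H(s,t,u,v),$$ and suppose that there is $T>0$ such that $|v(s,t)|\le r$ for all $t\in S^1$ whenever $|s|\ge T$. Then $|v|\le r$ on $\mathbb{R}\times S^1$. -/

import Mathlib

open Set Bundle Manifold
open scoped ContDiff

set_option linter.unusedSectionVars false
set_option synthInstance.maxHeartbeats 200000

noncomputable section

namespace FloerBound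

section Algebra

variable {E : Type*} [NormedAddCommGroup E] [NormedSpace ℝ E]

/-- The form `c ↦ ½ (D(a, b, c) + D(b, a, c) - D(c, a, b))` of a trilinear form `D`, bilinear in
`(a, b)`. -/
def koszul (D : E →L[ℝ] E →L[ℝ] E →L[ℝ] ℝ) : E →ₗ[ℝ] E →ₗ[ℝ] E →L[ℝ] ℝ :=
  LinearMap.mk₂ ℝ (fun a b => (1 / 2 : ℝ) • (D a b + D b a - (D.flip a).flip b))
    (fun a a' b => ContinuousLinearMap.ext fun c => by
      change 1 / 2 * (D (a + a') b c + D b (a + a') c - D c (a + a') b)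
        = 1 / 2 * (D a b c + D b a c - D c a b) + 1 / 2 * (D a' b c + D b a' c - D c a' b)
      rw [D.map_add, (D b).map_add, (D c).map_add]
      change 1 / 2 * ((D a b c + D a' b c) + (D b a c + D b a' c) - (D c a b + D c a' b)) = _
      ring)
    (fun k a b => ContinuousLinearMap.ext fun c => by
      change 1 / 2 * (D (k • a) b c + D b (k • a) c - D c (k • a) b)
        = k * (1 / 2 * (D a b c + D b a c - D c a b))
      rw [D.map_smul, (D b).map_smul, (D c).map_smul]
      change 1 / 2 * (k * D a b c + k * D b a c - k * D c a b) = _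
      ring)
    (fun a b b' => ContinuousLinearMap.ext fun c => by
      change 1 / 2 * (D a (b + b') c + D (b + b') a c - D c a (b + b'))
        = 1 / 2 * (D a b c + D b a c - D c a b) + 1 / 2 * (D a b' c + D b' a c - D c a b')
      rw [D.map_add, (D a).map_add, (D c a).map_add]
      change 1 / 2 * ((D a b c + D a b' c) + (D b a c + D b' a c) - (D c a b + D c a b')) = _
      ring)
    (fun k a b => ContinuousLinearMap.ext fun c => by
      change 1 / 2 * (D a (k • b) c + D (k • b) a c - D c a (k • b))
        = k * (1 / 2 * (D a b c + D b a c - D c a b))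
      rw [D.map_smul, (D a).map_smul, (D c a).map_smul]
      change 1 / 2 * (k * D a b c + k * D b a c - k * D c a b) = _
      ring)

theorem koszul_apply (D : E →L[ℝ] E →L[ℝ] E →L[ℝ] ℝ) (a b c : E) :
    koszul D a b c = 1 / 2 * (D a b c + D b a c - D c a b) :=
  rfl

end Algebra

section Geometry

variable {E : Type*} [NormedAddCommGroup E] [NormedSpace ℝ E] [FiniteDimensional ℝ E]
  {M : Type*} [TopologicalSpace M] [ChartedSpace E M] [IsManifold 𝓘(ℝ, E) ∞ M]
  [RiemannianBundle (fun x : M => TangentSpace 𝓘(ℝ, E) x)]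

instance instFiniteDimensionalTangentSpace (x : M) :
    FiniteDimensional ℝ (TangentSpace 𝓘(ℝ, E) x) :=
  inferInstanceAs (FiniteDimensional ℝ E)

instance instCompleteSpaceTangentSpace (x : M) :
    CompleteSpace (TangentSpace 𝓘(ℝ, E) x) :=
  FiniteDimensional.complete ℝ (TangentSpace 𝓘(ℝ, E) x)

/-- The tangent vector at `y` with given coordinates `a : E` in the preferred chart around `x`
(for `y` in the domain of that chart). -/
def ofCoord (x y : M) : E →L[ℝ] TangentSpace 𝓘(ℝ, E) y :=
  (trivializationAt E (TangentSpace 𝓘(ℝ, E)) x).symmL ℝ y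

/-- The coordinates, in the preferred chart around `x`, of a tangent vector at `y`. -/
def toCoord (x y : M) : TangentSpace 𝓘(ℝ, E) y →L[ℝ] E :=
  (trivializationAt E (TangentSpace 𝓘(ℝ, E)) x).continuousLinearMapAt ℝ y

/-- The Riemannian metric in the chart around `x`: the matrix `g_ij(p)`, as a bilinear form on `E`
depending on the coordinate point `p : E`. -/
def localMetric (x : M) (p : E) : E →L[ℝ] E →L[ℝ] ℝ :=
  (innerSL ℝ).bilinearComp (ofCoord x ((extChartAt 𝓘(ℝ, E) x).symm p))
      (ofCoord x ((extChartAt 𝓘(ℝ, E) x).symm p))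

/-- The derivative `∂_a g(b, c)` at `x` of the metric in the chart around `x`, as a trilinear form
`a ↦ b ↦ c ↦ ∂_a g(b, c)` on `E`. -/
def metricDeriv (x : M) : E →L[ℝ] E →L[ℝ] E →L[ℝ] ℝ :=
  (fderiv ℝ (localMetric x) (extChartAt 𝓘(ℝ, E) x x) :)

/-- The Riesz isomorphism: the tangent vector `v` at `x` with `⟨v, c⟩ = ℓ c` for all `c`. -/
def sharp (x : M) (ℓ : TangentSpace 𝓘(ℝ, E) x →L[ℝ] ℝ) : TangentSpace 𝓘(ℝ, E) x :=
  (InnerProductSpace.toDual ℝ (TangentSpace 𝓘(ℝ, E) x)).symm ℓ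

theorem inner_sharp (x : M) (ℓ : TangentSpace 𝓘(ℝ, E) x →L[ℝ] ℝ) (c : TangentSpace 𝓘(ℝ, E) x) :
    inner ℝ (sharp x ℓ) c = ℓ c :=
  InnerProductSpace.toDual_symm_apply

/-- The Christoffel symbol `Γ(a, b)` at `x` of the Levi-Civita connection, in the chart around `x`:
the tangent vector with `⟨Γ(a, b), c⟩ = ½ (∂_a g(b, c) + ∂_b g(a, c) - ∂_c g(a, b))` for all `c`. It
is bilinear in `(a, b)`. -/
def christoffel (x : M) :
    TangentSpace 𝓘(ℝ, E) x →ₗ[ℝ] TangentSpace 𝓘(ℝ, E) x →ₗ[ℝ] TangentSpace 𝓘(ℝ, E) x :=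
  LinearMap.mk₂ ℝ
    (fun a b => sharp x (koszul (metricDeriv x) (toCoord x x a) (toCoord x x b) ∘L toCoord x x))
    (fun a a' b => ext_inner_right ℝ fun c => by
      rw [inner_add_left, inner_sharp, inner_sharp, inner_sharp, map_add, map_add]
      rfl)
    (fun k a b => ext_inner_right ℝ fun c => by
      rw [real_inner_smul_left, inner_sharp, inner_sharp, map_smul, map_smul]
      rfl)
    (fun a b b' => ext_inner_right ℝ fun c => by
      rw [inner_add_left, inner_sharp, inner_sharp, inner_sharp, map_add, map_add]
      rfl)
    (fun k a b => ext_inner_right ℝ fun c => by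
      rw [real_inner_smul_left, inner_sharp, inner_sharp, map_smul, map_smul]
      rfl)

theorem inner_christoffel (x : M) (a b c : TangentSpace 𝓘(ℝ, E) x) :
    inner ℝ (christoffel x a b) c = 1 / 2 *
      (metricDeriv x (toCoord x x a) (toCoord x x b) (toCoord x x c)
        + metricDeriv x (toCoord x x b) (toCoord x x a) (toCoord x x c)
        - metricDeriv x (toCoord x x c) (toCoord x x a) (toCoord x x b)) :=
  inner_sharp x _ c

/-- The velocity of a curve in `M` at the time `τ`. -/
def velocity (γ : ℝ → M) (τ : ℝ) : TangentSpace 𝓘(ℝ, E) (γ τ) :=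
  mfderiv 𝓘(ℝ, ℝ) 𝓘(ℝ, E) γ τ (1 : ℝ)

/-- The Levi-Civita covariant derivative at the time `τ` of a vector field along a curve: for the
curve `σ ↦ (x(σ), y(σ))` in `TM` it is `y' + Γ(x', y)`, in the chart around `x(τ)`. -/
def covDeriv (z : ℝ → TangentBundle 𝓘(ℝ, E) M) (τ : ℝ) : TangentSpace 𝓘(ℝ, E) (z τ).proj :=
  ofCoord (z τ).proj (z τ).proj
      (deriv (fun σ => toCoord (z τ).proj (z σ).proj (z σ).2) τ)
    + christoffel (z τ).proj (velocity (fun σ => (z σ).proj) τ) (z τ).2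

/-- The fibre derivative `η ↦ dF(0, η)` of a function on `TM` at `z = (x, y)`: the derivative of
`y ↦ F(x, y)`. -/
def verticalDeriv (F : TangentBundle 𝓘(ℝ, E) M → ℝ) (z : TangentBundle 𝓘(ℝ, E) M) :
    TangentSpace 𝓘(ℝ, E) z.proj →L[ℝ] ℝ :=
  fderiv ℝ (fun y : TangentSpace 𝓘(ℝ, E) z.proj => F ⟨z.proj, y⟩) z.2

/-- The horizontal derivative `ξ ↦ dF(ξ, 0)` of a function on `TM` at `z = (x, y)`, where
`T_z TM = T_x M ⊕ T_x M` is the splitting `ż ↦ (ẋ, ∇y)` given by the Levi-Civita connection.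
In the chart around `x`, the vector with the components `(ẋ, ẏ)` equal to `(ξ, 0)` splits as
`(ξ, Γ(ξ, y))`, so that `dF(ξ, 0)` is the derivative of `F` along the section of `TM` with constant
coordinates through `y`, minus `dF(0, Γ(ξ, y))`. -/
def horizontalDeriv (F : TangentBundle 𝓘(ℝ, E) M → ℝ) (z : TangentBundle 𝓘(ℝ, E) M) :
    TangentSpace 𝓘(ℝ, E) z.proj →L[ℝ] ℝ :=
  mvfderiv 𝓘(ℝ, E)
      (fun x : M => F ⟨x, ofCoord z.proj x (toCoord z.proj z.proj z.2)⟩) z.proj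
    - verticalDeriv F z ∘L ((christoffel z.proj).flip z.2).toContinuousLinearMap

/-- The first (horizontal) component of the gradient of a function on `TM`, in
`T_z TM = T_x M ⊕ T_x M` with the metric `⟨ξ, ξ'⟩ + ⟨η, η'⟩`. -/
def horizontalGrad (F : TangentBundle 𝓘(ℝ, E) M → ℝ) (z : TangentBundle 𝓘(ℝ, E) M) :
    TangentSpace 𝓘(ℝ, E) z.proj :=
  sharp z.proj (horizontalDeriv F z)

/-- The second (vertical) component of the gradient of a function on `TM`. -/
def verticalGrad (F : TangentBundle 𝓘(ℝ, E) M → ℝ) (z : TangentBundle 𝓘(ℝ, E) M) :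
    TangentSpace 𝓘(ℝ, E) z.proj :=
  sharp z.proj (verticalDeriv F z)

/-- The `s`-dependent Floer equation for `w = (u, v) : ℝ × ℝ → TM`:
`(∂_s u - ∇_t v, ∇_s v + ∂_t u) = ∇H(s, t, u, v)`. -/
def SolvesFloer (H : ℝ → ℝ → TangentBundle 𝓘(ℝ, E) M → ℝ)
    (w : ℝ → ℝ → TangentBundle 𝓘(ℝ, E) M) : Prop :=
  ∀ s t : ℝ,
    velocity (fun σ => (w σ t).proj) s - covDeriv (fun τ => w s τ) t
        = horizontalGrad (H s t) (w s t) ∧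
    covDeriv (fun σ => w σ t) s + velocity (fun τ => (w s τ).proj) t
        = verticalGrad (H s t) (w s t)

end Geometry

/-- A family `f_s : [r, ∞) → ℝ` of smooth functions, of class `C¹` in the parameter `s`: the map
`s ↦ f_s` into the smooth functions is `C¹`, that is, all derivatives in the variable `ρ ∈ [r, ∞)`
are `C¹` functions of `(s, ρ)`. -/
structure IsC1Family (r : ℝ) (f : ℝ → ℝ → ℝ) : Prop where
  smooth : ∀ s, ContDiffOn ℝ ∞ (f s) (Ici r)
  c1 : ∀ k : ℕ, ContDiffOn ℝ 1
    (fun q : ℝ × ℝ => iteratedDerivWithin k (f q.1) (Ici r) q.2) (univ ×ˢ Ici r)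

end FloerBound

end

/-!
The function `φ = |v|² / 2` is a subsolution where `|v| > r`, and the maximum principle bounds it.

Where `|v| > r`, the function `H(s, t, ·)` depends on `|y|` only. Its horizontal gradient vanishes
there because parallel transport preserves the norm (`horizontalGrad_radial`), and its vertical
gradient is `f_s'(|y|) y / |y|` (`verticalGrad_radial`); hence `∂_s u = ∇_t v` and
`∂_t u = f_s'(|v|) v / |v| - ∇_s v`. Since the Levi-Civita connection is compatible with the metric
(`hasDerivAt_inner`) and torsion free (`covDeriv_velocity_comm`), differentiating
`∂_t φ = ⟨∂_s u, v⟩` and `∂_s φ = f_s'(|v|) |v| - ⟨∂_t u, v⟩` once more gives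
`Δφ = |∇_s v|² + |∇_t v|² + |v| (∂_s f_s')(|v|) + f_s''(|v|) ∂_s φ`,
so that `Δφ ≥ f_s''(|v|) ∂_s φ` by monotonicity in `s` (`exists_subsolution_derivs`).

If `φ` exceeded `r² / 2` somewhere, then for small `ε > 0` the function `φ + ε exp (l s)` would
attain its maximum over `[-T, T] × ℝ/ℤ` at an interior point with `|v| > r`. The derivative tests
there give `l² ≤ f_s''(|v|) l`, which is false for `l = c + 1` if `f_s'' ≤ c` and for `l = -(c + 1)`
if `f_s'' ≥ -c` (`cylinder_maximum_principle`).
-/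

open Filter Topology

/-! ### Calculus in normed spaces -/

theorem IsLocalMax.second_deriv_nonpos {g g' : ℝ → ℝ} {x g'' : ℝ} (hmax : IsLocalMax g x)
    (h : ∀ᶠ y in 𝓝 x, HasDerivAt g (g' y) y) (h2 : HasDerivAt g' g'' x) : g'' ≤ 0 := by
  by_contra! hpos
  have hd : deriv g =ᶠ[𝓝 x] g' := h.mono fun y hy => hy.deriv
  have hdd : deriv (deriv g) x = g'' := hd.deriv_eq.trans h2.deriv
  have hmin : IsLocalMin g x :=
    isLocalMin_of_deriv_deriv_pos (by rw [hdd]; exact hpos) hmax.deriv_eq_zero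
      h.self_of_nhds.continuousAt
  -- a point that is both a local maximum and a local minimum has a constant neighbourhood
  have hconst : g =ᶠ[𝓝 x] fun _ => g x := by
    filter_upwards [hmax, hmin] with y h1 h2 using le_antisymm h1 h2
  have h0 : deriv g =ᶠ[𝓝 x] fun _ => 0 := by simpa using hconst.deriv
  have : deriv (deriv g) x = 0 := by simpa using h0.deriv_eq
  linarith

theorem hasDerivAt_comp_clm_apply {E F : Type*} [NormedAddCommGroup E] [NormedSpace ℝ E]
    [NormedAddCommGroup F] [NormedSpace ℝ F] {G : E → E →L[ℝ] F} {p A : ℝ → E} {p' A' : E} {τ : ℝ}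
    (hG : DifferentiableAt ℝ G (p τ)) (hp : HasDerivAt p p' τ) (hA : HasDerivAt A A' τ) :
    HasDerivAt (fun σ => G (p σ) (A σ)) (fderiv ℝ G (p τ) p' (A τ) + G (p τ) A') τ :=
  (hG.hasFDerivAt.comp_hasDerivAt τ hp).clm_apply hA

theorem hasDerivAt_comp_clm_apply₂ {E : Type*} [NormedAddCommGroup E] [NormedSpace ℝ E]
    {G : E → E →L[ℝ] E →L[ℝ] ℝ} {p A B : ℝ → E} {p' A' B' : E} {τ : ℝ}
    (hG : DifferentiableAt ℝ G (p τ)) (hp : HasDerivAt p p' τ) (hA : HasDerivAt A A' τ)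
    (hB : HasDerivAt B B' τ) :
    HasDerivAt (fun σ => G (p σ) (A σ) (B σ))
      (fderiv ℝ G (p τ) p' (A τ) (B τ) + G (p τ) A' (B τ) + G (p τ) (A τ) B') τ := by
  have h := (hasDerivAt_comp_clm_apply hG hp hA).clm_apply hB
  rwa [add_apply] at h

theorem hasDerivAt_fderiv_comp_apply {V E : Type*} [NormedAddCommGroup V] [NormedSpace ℝ V]
    [NormedAddCommGroup E] [NormedSpace ℝ E] {P : V → E} {γ : ℝ → V} {γ' : V} {τ : ℝ}
    (hP : ContDiffAt ℝ 2 P (γ τ)) (hγ : HasDerivAt γ γ' τ) (v : V) :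
    HasDerivAt (fun τ => fderiv ℝ P (γ τ) v) (fderiv ℝ (fderiv ℝ P) (γ τ) γ' v) τ := by
  have h := (hP.fderiv_right (m := 1) le_rfl).differentiableAt one_ne_zero
  simpa using (h.hasFDerivAt.comp_hasDerivAt τ hγ).clm_apply (hasDerivAt_const τ v)

theorem hasFDerivAt_comp_norm {V : Type*} [NormedAddCommGroup V] [InnerProductSpace ℝ V]
    {h : ℝ → ℝ} {h' : ℝ} {y : V} (hy : y ≠ 0) (hh : HasDerivAt h h' ‖y‖) :
    HasFDerivAt (fun y => h ‖y‖) ((h' / ‖y‖) • innerSL ℝ y) y := by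
  have hpos : 0 < ‖y‖ := norm_pos_iff.2 hy
  have h1 : HasFDerivAt (fun y : V => ‖y‖ ^ 2) (2 • innerSL ℝ y) y :=
    (hasStrictFDerivAt_norm_sq y).hasFDerivAt
  have h2 : HasFDerivAt (fun y : V => √(‖y‖ ^ 2)) _ y := h1.sqrt (by positivity)
  simp only [Real.sqrt_sq (norm_nonneg _)] at h2
  have h3 := hh.comp_hasFDerivAt y h2
  refine h3.congr_fderiv (ContinuousLinearMap.ext fun c => ?_)
  simp
  field_simp

/-! ### A maximum principle on the cylinder -/

/-- The maximum principle on the cylinder `ℝ × ℝ/ℤ` for the operator `Δ - k ∂_s`: a function that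
is at most `R` for large `|s|`, and a subsolution wherever it exceeds `R`, is at most `R`
everywhere. The function `exp (l s)` is a strict subsolution because `k l < l ^ 2`; `k` need only be
bounded on one side for such an `l` to exist. -/
theorem cylinder_maximum_principle {φ k : ℝ → ℝ → ℝ} {R T l : ℝ}
    (hcont : Continuous fun q : ℝ × ℝ => φ q.1 q.2) (hper : ∀ s t, φ s (t + 1) = φ s t)
    (hends : ∀ s t, T ≤ |s| → φ s t ≤ R) (hl : ∀ s t, R < φ s t → k s t * l < l ^ 2)
    (hsub : ∀ s t, R < φ s t → ∃ (a b : ℝ → ℝ) (a' b' : ℝ),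
      (∀ᶠ σ in 𝓝 s, HasDerivAt (fun σ => φ σ t) (a σ) σ) ∧ HasDerivAt a a' s ∧
      (∀ᶠ τ in 𝓝 t, HasDerivAt (fun τ => φ s τ) (b τ) τ) ∧ HasDerivAt b b' t ∧
      k s t * a s ≤ a' + b') (s t : ℝ) : φ s t ≤ R := by
  by_contra! hR
  obtain ⟨t₀, ht₀, hφ₀⟩ : ∃ t₀ ∈ Ico (0 : ℝ) 1, φ s t = φ s t₀ :=
    Function.Periodic.exists_mem_Ico₀ (f := φ s) (c := 1) (fun t => hper s t) one_pos t
  have hs : |s| < T := by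
    by_contra! h
    exact (hends s t h).not_gt hR
  set B := Real.exp (|l| * T) with hB
  have hBpos : 0 < B := Real.exp_pos _
  -- `ε` is so small that the perturbation, at most `ε B` for `|s| ≤ T`, does not fill the gap
  -- between `R` and `φ s t`
  obtain ⟨ε, hε, hεB⟩ : ∃ ε > 0, ε * B < φ s t - R :=
    ⟨(φ s t - R) / (2 * B), by positivity [sub_pos.2 hR], by field_simp; linarith⟩
  have hexp : ∀ σ, |σ| ≤ T → Real.exp (l * σ) ≤ B := fun σ hσ =>
    Real.exp_le_exp.2 <| (le_abs_self _).trans <| by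
      rw [abs_mul]; exact mul_le_mul_of_nonneg_left hσ (abs_nonneg _)
  set ψ : ℝ → ℝ → ℝ := fun σ τ => φ σ τ + ε * Real.exp (l * σ) with hψ
  have hψc : Continuous fun q : ℝ × ℝ => ψ q.1 q.2 := by fun_prop
  obtain ⟨⟨s₁, t₁⟩, ⟨hs₁, ht₁⟩, hmax⟩ :=
    (isCompact_Icc (a := -T) (b := T)).prod (isCompact_Icc (a := (0 : ℝ)) (b := 1))
      |>.exists_isMaxOn ⟨(s, t₀), abs_le.1 hs.le, Ico_subset_Icc_self ht₀⟩ hψc.continuousOn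
  have hmax' : ∀ σ τ, |σ| ≤ T → ψ σ τ ≤ ψ s₁ t₁ := by
    intro σ τ hσ
    obtain ⟨τ₀, hτ₀, h⟩ : ∃ τ₀ ∈ Ico (0 : ℝ) 1, φ σ τ = φ σ τ₀ :=
      Function.Periodic.exists_mem_Ico₀ (f := φ σ) (c := 1) (fun t => hper σ t) one_pos τ
    have : ψ σ τ₀ ≤ ψ s₁ t₁ :=
      hmax (show (σ, τ₀) ∈ Icc (-T) T ×ˢ Icc 0 1 from ⟨abs_le.1 hσ, Ico_subset_Icc_self hτ₀⟩)
    simpa only [hψ, h] using this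
  have hR₁ : R < φ s₁ t₁ := by
    have h1 := hmax' s t hs.le
    have h2 := mul_le_mul_of_nonneg_left (hexp s₁ (abs_le.2 hs₁)) hε.le
    have h3 : 0 < ε * Real.exp (l * s) := by positivity
    simp only [hψ] at h1
    linarith
  have hs₁' : |s₁| < T := by
    by_contra! h
    exact (hends s₁ t₁ h).not_gt hR₁
  obtain ⟨a, b, a', b', ha, ha', hb, hb', hk⟩ := hsub s₁ t₁ hR₁
  have hexpd : ∀ σ, HasDerivAt (fun σ => ε * Real.exp (l * σ)) (ε * (l * Real.exp (l * σ))) σ :=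
    fun σ => by
      have := (((hasDerivAt_id σ).const_mul l).exp).const_mul ε
      simpa [mul_comm, mul_left_comm, mul_assoc] using this
  have hmaxs : IsLocalMax (fun σ => ψ σ t₁) s₁ := by
    have : ∀ᶠ σ in 𝓝 s₁, |σ| < T := continuous_abs.continuousAt.eventually_lt_const hs₁'
    filter_upwards [this] with σ hσ using hmax' σ t₁ hσ.le
  have hmaxt : IsLocalMax (fun τ => φ s₁ τ) t₁ :=
    Eventually.of_forall fun τ => by simpa [hψ] using hmax' s₁ τ hs₁'.le
  have hψs : ∀ᶠ σ in 𝓝 s₁, HasDerivAt (fun σ => ψ σ t₁) (a σ + ε * (l * Real.exp (l * σ))) σ :=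
    ha.mono fun σ h => h.add (hexpd σ)
  have h1 : a s₁ + ε * (l * Real.exp (l * s₁)) = 0 := hmaxs.hasDerivAt_eq_zero hψs.self_of_nhds
  have h2 : a' + l * (ε * (l * Real.exp (l * s₁))) ≤ 0 :=
    hmaxs.second_deriv_nonpos hψs (ha'.add (by
      have := (hexpd s₁).const_mul l
      refine this.congr_of_eventuallyEq (Eventually.of_forall fun σ => ?_)
      ring))
  have h3 : b' ≤ 0 := hmaxt.second_deriv_nonpos hb hb'
  have h4 : 0 < ε * Real.exp (l * s₁) := by positivity
  have h5 := mul_lt_mul_of_pos_right (hl s₁ t₁ hR₁) h4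
  rw [eq_neg_of_add_eq_zero_left h1] at hk
  nlinarith

namespace FloerBound

/-! ### The Levi-Civita connection in a chart -/

section LocalGeometry

variable {E : Type*} [NormedAddCommGroup E] [NormedSpace ℝ E] [FiniteDimensional ℝ E]
  {M : Type*} [TopologicalSpace M] [ChartedSpace E M] [IsManifold 𝓘(ℝ, E) ∞ M]
  [RiemannianBundle (fun x : M => TangentSpace 𝓘(ℝ, E) x)]

theorem toCoord_ofCoord {x y : M} (hy : y ∈ (chartAt E x).source) (a : E) :
    toCoord x y (ofCoord x y a) = a :=
  (trivializationAt E (TangentSpace 𝓘(ℝ, E)) x).continuousLinearMapAt_symmL (R := ℝ) hy a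

theorem ofCoord_toCoord {x y : M} (hy : y ∈ (chartAt E x).source) (v : TangentSpace 𝓘(ℝ, E) y) :
    ofCoord x y (toCoord x y v) = v :=
  (trivializationAt E (TangentSpace 𝓘(ℝ, E)) x).symmL_continuousLinearMapAt (R := ℝ) hy v

theorem toCoord_eq_trivializationAt {x y : M} (hy : y ∈ (chartAt E x).source)
    (v : TangentSpace 𝓘(ℝ, E) y) :
    toCoord x y v = (trivializationAt E (TangentSpace 𝓘(ℝ, E)) x ⟨y, v⟩).2 := by
  rw [toCoord, Trivialization.continuousLinearMapAt_apply, Trivialization.linearMapAt_apply]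
  exact if_pos hy

theorem toCoord_eq_mfderiv {x y : M} (hy : y ∈ (chartAt E x).source)
    (v : TangentSpace 𝓘(ℝ, E) y) :
    toCoord x y v = mfderiv 𝓘(ℝ, E) 𝓘(ℝ, E) (extChartAt 𝓘(ℝ, E) x) y v := by
  rw [toCoord, TangentBundle.continuousLinearMapAt_trivializationAt hy]
  rfl

/-- The velocity of a curve in coordinates is the derivative of the coordinate curve. -/
theorem hasDerivAt_extChartAt_comp {x : M} {γ : ℝ → M} {τ : ℝ} (hτ : γ τ ∈ (chartAt E x).source)
    (hγ : MDifferentiableAt 𝓘(ℝ, ℝ) 𝓘(ℝ, E) γ τ) :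
    HasDerivAt (fun σ => extChartAt 𝓘(ℝ, E) x (γ σ)) (toCoord x (γ τ) (velocity γ τ)) τ := by
  have h1 : MDifferentiableAt 𝓘(ℝ, E) 𝓘(ℝ, E) (extChartAt 𝓘(ℝ, E) x) (γ τ) :=
    mdifferentiableAt_extChartAt hτ
  have h2 : HasFDerivAt (fun σ => extChartAt 𝓘(ℝ, E) x (γ σ))
      (mfderiv 𝓘(ℝ, E) 𝓘(ℝ, E) (extChartAt 𝓘(ℝ, E) x) (γ τ) ∘L mfderiv 𝓘(ℝ, ℝ) 𝓘(ℝ, E) γ τ :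
        ℝ →L[ℝ] E) τ :=
    (h1.hasMFDerivAt.comp τ hγ.hasMFDerivAt).hasFDerivAt
  rw [toCoord_eq_mfderiv hτ]
  exact h2.hasDerivAt

theorem localMetric_apply (x : M) (p a b : E) :
    localMetric x p a b = inner ℝ (ofCoord x ((extChartAt 𝓘(ℝ, E) x).symm p) a)
      (ofCoord x ((extChartAt 𝓘(ℝ, E) x).symm p) b) :=
  rfl

theorem localMetric_symm (x : M) (p a b : E) : localMetric x p a b = localMetric x p b a := by
  rw [localMetric_apply, localMetric_apply, real_inner_comm]

theorem inner_eq_localMetric {x y : M} (hy : y ∈ (chartAt E x).source)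
    (v w : TangentSpace 𝓘(ℝ, E) y) :
    inner ℝ v w = localMetric x (extChartAt 𝓘(ℝ, E) x y) (toCoord x y v) (toCoord x y w) := by
  rw [localMetric_apply, (extChartAt 𝓘(ℝ, E) x).left_inv (by simpa using hy), ofCoord_toCoord hy,
    ofCoord_toCoord hy]

theorem hasFDerivAt_localMetric_apply {x : M}
    (hd : DifferentiableAt ℝ (localMetric x) (extChartAt 𝓘(ℝ, E) x x)) (b c : E) :
    HasFDerivAt (fun p => localMetric x p b c) (((metricDeriv x).flip b).flip c)
      (extChartAt 𝓘(ℝ, E) x x) := by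
  have := (hd.hasFDerivAt.clm_apply (hasFDerivAt_const b _)).clm_apply (hasFDerivAt_const c _)
  refine this.congr_fderiv (ContinuousLinearMap.ext fun a => ?_)
  simp [metricDeriv]

theorem metricDeriv_symm {x : M}
    (hd : DifferentiableAt ℝ (localMetric x) (extChartAt 𝓘(ℝ, E) x x)) (a b c : E) :
    metricDeriv x a b c = metricDeriv x a c b := by
  have h := hasFDerivAt_localMetric_apply hd b c
  simp_rw [localMetric_symm x _ b c] at h
  exact DFunLike.congr_fun (h.unique (hasFDerivAt_localMetric_apply hd c b)) a

section Smooth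

variable [IsContMDiffRiemannianBundle 𝓘(ℝ, E) ∞ E (fun x : M => TangentSpace 𝓘(ℝ, E) x)]

theorem contDiffOn_localMetric (x : M) :
    ContDiffOn ℝ ∞ (localMetric x) (extChartAt 𝓘(ℝ, E) x).target := by
  have key : ∀ a : E, ContMDiffOn 𝓘(ℝ, E) 𝓘(ℝ, E).tangent ∞
      (fun p : E => (⟨(extChartAt 𝓘(ℝ, E) x).symm p,
        ofCoord x ((extChartAt 𝓘(ℝ, E) x).symm p) a⟩ : TangentBundle 𝓘(ℝ, E) M))
      (extChartAt 𝓘(ℝ, E) x).target := by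
    intro a p hp
    have hy : (extChartAt 𝓘(ℝ, E) x).symm p ∈ (chartAt E x).source := by
      simpa using (extChartAt 𝓘(ℝ, E) x).map_target hp
    refine ContMDiffAt.contMDiffWithinAt ?_
    have hsymm : ContMDiffAt 𝓘(ℝ, E) 𝓘(ℝ, E) ∞ (extChartAt 𝓘(ℝ, E) x).symm p :=
      (contMDiffOn_extChartAt_symm x).contMDiffAt (extChartAt_target_mem_nhds' hp)
    rw [(trivializationAt E (TangentSpace 𝓘(ℝ, E)) x).contMDiffAt_iff
      (by simpa [Trivialization.mem_source] using hy)]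
    refine ⟨hsymm, ?_⟩
    refine (contMDiffAt_const (c := a)).congr_of_eventuallyEq ?_
    filter_upwards [hsymm.continuousAt.preimage_mem_nhds
      ((chartAt E x).open_source.mem_nhds hy)] with q hq
    rw [← toCoord_eq_trivializationAt hq, toCoord_ofCoord hq]
  rw [contDiffOn_clm_apply]
  intro a
  rw [contDiffOn_clm_apply]
  intro b
  have h : ContMDiffOn 𝓘(ℝ, E) 𝓘(ℝ, ℝ) ∞ (fun p => inner ℝ
      (ofCoord x ((extChartAt 𝓘(ℝ, E) x).symm p) a) (ofCoord x ((extChartAt 𝓘(ℝ, E) x).symm p) b))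
      (extChartAt 𝓘(ℝ, E) x).target :=
    ContMDiffOn.inner_bundle (E := fun x : M => TangentSpace 𝓘(ℝ, E) x) (key a) (key b)
  exact h.contDiffOn

theorem differentiableAt_localMetric (x : M) :
    DifferentiableAt ℝ (localMetric x) (extChartAt 𝓘(ℝ, E) x x) :=
  ((contDiffOn_localMetric x).contDiffAt (extChartAt_target_mem_nhds x)).differentiableAt (by simp)

theorem christoffel_symm (x : M) (a b : TangentSpace 𝓘(ℝ, E) x) :
    christoffel x a b = christoffel x b a := by
  refine ext_inner_right ℝ fun c => ?_
  rw [inner_christoffel, inner_christoffel,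
    metricDeriv_symm (differentiableAt_localMetric x) (toCoord x x c) (toCoord x x a)]
  ring

theorem inner_covDeriv {γ : ℝ → M} {τ : ℝ} (a : ∀ σ, TangentSpace 𝓘(ℝ, E) (γ σ))
    (c : TangentSpace 𝓘(ℝ, E) (γ τ)) :
    inner ℝ (covDeriv (fun σ => ⟨γ σ, a σ⟩) τ) c =
      localMetric (γ τ) (extChartAt 𝓘(ℝ, E) (γ τ) (γ τ))
        (deriv (fun σ => toCoord (γ τ) (γ σ) (a σ)) τ) (toCoord (γ τ) (γ τ) c) +
      1 / 2 *
        (metricDeriv (γ τ) (toCoord (γ τ) (γ τ) (velocity γ τ)) (toCoord (γ τ) (γ τ) (a τ))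
            (toCoord (γ τ) (γ τ) c)
          + metricDeriv (γ τ) (toCoord (γ τ) (γ τ) (a τ)) (toCoord (γ τ) (γ τ) (velocity γ τ))
            (toCoord (γ τ) (γ τ) c)
          - metricDeriv (γ τ) (toCoord (γ τ) (γ τ) c) (toCoord (γ τ) (γ τ) (velocity γ τ))
            (toCoord (γ τ) (γ τ) (a τ))) := by
  have hs : γ τ ∈ (chartAt E (γ τ)).source := mem_chart_source E _
  rw [covDeriv, inner_add_left, inner_christoffel, inner_eq_localMetric hs, toCoord_ofCoord hs]

/-- The Levi-Civita connection is compatible with the metric. Both covariant derivatives are taken in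
the chart around `γ τ`, so that no comparison of Christoffel symbols between charts is needed. -/
theorem hasDerivAt_inner {γ : ℝ → M} {τ : ℝ} {a b : ∀ σ, TangentSpace 𝓘(ℝ, E) (γ σ)}
    (hγ : MDifferentiableAt 𝓘(ℝ, ℝ) 𝓘(ℝ, E) γ τ)
    (ha : DifferentiableAt ℝ (fun σ => toCoord (γ τ) (γ σ) (a σ)) τ)
    (hb : DifferentiableAt ℝ (fun σ => toCoord (γ τ) (γ σ) (b σ)) τ) :
    HasDerivAt (fun σ => inner ℝ (a σ) (b σ))
      (inner ℝ (covDeriv (fun σ => ⟨γ σ, a σ⟩) τ) (b τ)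
        + inner ℝ (a τ) (covDeriv (fun σ => ⟨γ σ, b σ⟩) τ)) τ := by
  have hs : γ τ ∈ (chartAt E (γ τ)).source := mem_chart_source E _
  have hp := hasDerivAt_extChartAt_comp hs hγ
  have hd : DifferentiableAt ℝ (localMetric (γ τ)) (extChartAt 𝓘(ℝ, E) (γ τ) (γ τ)) :=
    differentiableAt_localMetric _
  have key := hasDerivAt_comp_clm_apply₂ (p := fun σ => extChartAt 𝓘(ℝ, E) (γ τ) (γ σ)) hd hp
    ha.hasDerivAt hb.hasDerivAt
  have hev : (fun σ => inner ℝ (a σ) (b σ)) =ᶠ[𝓝 τ] fun σ =>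
      localMetric (γ τ) (extChartAt 𝓘(ℝ, E) (γ τ) (γ σ)) (toCoord (γ τ) (γ σ) (a σ))
        (toCoord (γ τ) (γ σ) (b σ)) := by
    filter_upwards [hγ.continuousAt.preimage_mem_nhds (chart_source_mem_nhds E (γ τ))] with σ hσ
    exact inner_eq_localMetric hσ _ _
  refine (key.congr_of_eventuallyEq hev).congr_deriv ?_
  have hsym := metricDeriv_symm hd
  have h1 := inner_covDeriv a (b τ)
  have h2 := inner_covDeriv b (a τ)
  rw [real_inner_comm] at h2
  rw [h1, h2, ← metricDeriv, localMetric_symm _ _ (deriv (fun σ => toCoord (γ τ) (γ σ) (b σ)) τ),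
    hsym (toCoord (γ τ) (γ τ) (velocity γ τ)) (toCoord (γ τ) (γ τ) (b τ)),
    hsym (toCoord (γ τ) (γ τ) (b τ)), hsym (toCoord (γ τ) (γ τ) (a τ))]
  ring

end Smooth

end LocalGeometry

/-! ### Vector fields along a map from the plane -/

section Surface

variable {E : Type*} [NormedAddCommGroup E] [NormedSpace ℝ E] [FiniteDimensional ℝ E]
  {M : Type*} [TopologicalSpace M] [ChartedSpace E M] [IsManifold 𝓘(ℝ, E) ∞ M]
  [RiemannianBundle (fun x : M => TangentSpace 𝓘(ℝ, E) x)]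

theorem mdifferentiableAt_proj {z : ℝ → TangentBundle 𝓘(ℝ, E) M} {τ : ℝ}
    (hz : ContMDiffAt 𝓘(ℝ, ℝ) 𝓘(ℝ, E).tangent ∞ z τ) :
    MDifferentiableAt 𝓘(ℝ, ℝ) 𝓘(ℝ, E) (fun σ => (z σ).proj) τ :=
  (contMDiffAt_totalSpace.1 hz).1.mdifferentiableAt (by simp)

theorem differentiableAt_toCoord {z : ℝ → TangentBundle 𝓘(ℝ, E) M} {τ : ℝ}
    (hz : ContMDiffAt 𝓘(ℝ, ℝ) 𝓘(ℝ, E).tangent ∞ z τ) :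
    DifferentiableAt ℝ (fun σ => toCoord (z τ).proj (z σ).proj (z σ).2) τ := by
  have h1 := (contMDiffAt_totalSpace.1 hz).1
  have h2 := (contMDiffAt_totalSpace.1 hz).2.contDiffAt.differentiableAt (by simp)
  refine h2.congr_of_eventuallyEq ?_
  filter_upwards [h1.continuousAt.preimage_mem_nhds (chart_source_mem_nhds E (z τ).proj)] with σ hσ
  exact toCoord_eq_trivializationAt hσ _

theorem contDiffAt_extChartAt_comp {u : ℝ × ℝ → M} {x : M} {q : ℝ × ℝ}
    (hu : ContMDiffAt 𝓘(ℝ, ℝ × ℝ) 𝓘(ℝ, E) ∞ u q) (hq : u q ∈ (chartAt E x).source) :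
    ContDiffAt ℝ ∞ (fun q => extChartAt 𝓘(ℝ, E) x (u q)) q :=
  ((contMDiffAt_extChartAt' hq).comp q hu).contDiffAt

variable {u : ℝ × ℝ → M} (hu : ContMDiff 𝓘(ℝ, ℝ × ℝ) 𝓘(ℝ, E) ∞ u)
include hu

theorem toCoord_velocity_fst {x : M} {s t : ℝ} (hq : u (s, t) ∈ (chartAt E x).source) :
    toCoord x (u (s, t)) (velocity (fun σ => u (σ, t)) s) =
      fderiv ℝ (fun q => extChartAt 𝓘(ℝ, E) x (u q)) (s, t) (1, 0) := by
  have hγ : ContMDiff 𝓘(ℝ, ℝ) 𝓘(ℝ, E) ∞ (fun σ => u (σ, t)) :=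
    hu.comp (contDiff_id.prodMk contDiff_const).contMDiff
  have h1 := hasDerivAt_extChartAt_comp hq (hγ.mdifferentiable (by simp) s)
  have h2 := ((contDiffAt_extChartAt_comp (hu _) hq).differentiableAt
    (by simp)).hasFDerivAt.comp_hasDerivAt s ((hasDerivAt_id s).prodMk (hasDerivAt_const s t))
  exact h1.unique h2

theorem toCoord_velocity_snd {x : M} {s t : ℝ} (hq : u (s, t) ∈ (chartAt E x).source) :
    toCoord x (u (s, t)) (velocity (fun τ => u (s, τ)) t) =
      fderiv ℝ (fun q => extChartAt 𝓘(ℝ, E) x (u q)) (s, t) (0, 1) := by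
  have hγ : ContMDiff 𝓘(ℝ, ℝ) 𝓘(ℝ, E) ∞ (fun τ => u (s, τ)) :=
    hu.comp (contDiff_const.prodMk contDiff_id).contMDiff
  have h1 := hasDerivAt_extChartAt_comp hq (hγ.mdifferentiable (by simp) t)
  have h2 := ((contDiffAt_extChartAt_comp (hu _) hq).differentiableAt
    (by simp)).hasFDerivAt.comp_hasDerivAt t ((hasDerivAt_const t s).prodMk (hasDerivAt_id t))
  exact h1.unique h2

theorem hasDerivAt_toCoord_velocity_fst (s t : ℝ) :
    HasDerivAt (fun τ => toCoord (u (s, t)) (u (s, τ)) (velocity (fun σ => u (σ, τ)) s))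
      (fderiv ℝ (fderiv ℝ (fun q => extChartAt 𝓘(ℝ, E) (u (s, t)) (u q))) (s, t) (0, 1) (1, 0))
      t := by
  have hP := contDiffAt_extChartAt_comp (hu _) (mem_chart_source E (u (s, t)))
  refine (hasDerivAt_fderiv_comp_apply (hP.of_le ENat.LEInfty.out)
    ((hasDerivAt_const t s).prodMk (hasDerivAt_id t)) (1, 0)).congr_of_eventuallyEq ?_
  have hc : Continuous fun τ => u (s, τ) := hu.continuous.comp (by fun_prop)
  filter_upwards [hc.continuousAt.preimage_mem_nhds (chart_source_mem_nhds E (u (s, t)))] with τ hτ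
  exact toCoord_velocity_fst hu hτ

theorem hasDerivAt_toCoord_velocity_snd (s t : ℝ) :
    HasDerivAt (fun σ => toCoord (u (s, t)) (u (σ, t)) (velocity (fun τ => u (σ, τ)) t))
      (fderiv ℝ (fderiv ℝ (fun q => extChartAt 𝓘(ℝ, E) (u (s, t)) (u q))) (s, t) (1, 0) (0, 1))
      s := by
  have hP := contDiffAt_extChartAt_comp (hu _) (mem_chart_source E (u (s, t)))
  refine (hasDerivAt_fderiv_comp_apply (γ := fun σ => (σ, t)) (hP.of_le ENat.LEInfty.out)
    ((hasDerivAt_id s).prodMk (hasDerivAt_const s t)) (0, 1)).congr_of_eventuallyEq ?_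
  have hc : Continuous fun σ => u (σ, t) := hu.continuous.comp (by fun_prop)
  filter_upwards [hc.continuousAt.preimage_mem_nhds (chart_source_mem_nhds E (u (s, t)))] with σ hσ
  exact toCoord_velocity_snd hu hσ

/-- The Levi-Civita connection is torsion free: `∇_t ∂_s u = ∇_s ∂_t u`. -/
theorem covDeriv_velocity_comm
    [IsContMDiffRiemannianBundle 𝓘(ℝ, E) ∞ E (fun x : M => TangentSpace 𝓘(ℝ, E) x)] (s t : ℝ) :
    covDeriv (fun τ => (⟨u (s, τ), velocity (fun σ => u (σ, τ)) s⟩ : TangentBundle 𝓘(ℝ, E) M)) t =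
      covDeriv (fun σ => (⟨u (σ, t), velocity (fun τ => u (σ, τ)) t⟩ : TangentBundle 𝓘(ℝ, E) M))
        s := by
  have hP := contDiffAt_extChartAt_comp (hu _) (mem_chart_source E (u (s, t)))
  have hsymm := hP.isSymmSndFDerivAt (by simpa using ENat.LEInfty.out) (0, 1) (1, 0)
  have h1 := (hasDerivAt_toCoord_velocity_fst hu s t).deriv
  have h2 := (hasDerivAt_toCoord_velocity_snd hu s t).deriv
  simp only [covDeriv]
  rw [h1, h2, hsymm, christoffel_symm]

end Surface

/-! ### The gradient of a radial function on the tangent bundle -/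

section Radial

variable {E : Type*} [NormedAddCommGroup E] [NormedSpace ℝ E] [FiniteDimensional ℝ E]
  {M : Type*} [TopologicalSpace M] [ChartedSpace E M] [IsManifold 𝓘(ℝ, E) ∞ M]
  [RiemannianBundle (fun x : M => TangentSpace 𝓘(ℝ, E) x)]
  {F : TangentBundle 𝓘(ℝ, E) M → ℝ} {h : ℝ → ℝ} {h' r : ℝ} {x : M} {y : TangentSpace 𝓘(ℝ, E) x}

theorem verticalDeriv_radial (hF : ∀ y : TangentSpace 𝓘(ℝ, E) x, r ≤ ‖y‖ → F ⟨x, y⟩ = h ‖y‖)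
    (hr : 0 ≤ r) (hy : r < ‖y‖) (hh : HasDerivAt h h' ‖y‖) (c : TangentSpace 𝓘(ℝ, E) x) :
    verticalDeriv F ⟨x, y⟩ c = h' / ‖y‖ * inner ℝ y c := by
  have hy0 : y ≠ 0 := norm_pos_iff.1 (hr.trans_lt hy)
  have hev : (fun y : TangentSpace 𝓘(ℝ, E) x => F ⟨x, y⟩) =ᶠ[𝓝 y] fun y => h ‖y‖ := by
    filter_upwards [continuous_norm.continuousAt.eventually_const_lt hy] with y hy using hF y hy.le
  have h1 := ((hasFDerivAt_comp_norm hy0 hh).congr_of_eventuallyEq hev).fderiv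
  rw [verticalDeriv, h1]
  rfl

theorem verticalGrad_radial (hF : ∀ y : TangentSpace 𝓘(ℝ, E) x, r ≤ ‖y‖ → F ⟨x, y⟩ = h ‖y‖)
    (hr : 0 ≤ r) (hy : r < ‖y‖) (hh : HasDerivAt h h' ‖y‖) :
    verticalGrad F ⟨x, y⟩ = (h' / ‖y‖) • y := by
  refine ext_inner_right ℝ fun c => ?_
  rw [verticalGrad, inner_sharp, verticalDeriv_radial hF hr hy hh, real_inner_smul_left]

variable [IsContMDiffRiemannianBundle 𝓘(ℝ, E) ∞ E (fun x : M => TangentSpace 𝓘(ℝ, E) x)]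

/-- A function of `|y|` alone has no horizontal gradient: in the chart around `x`, its derivative
along the section with constant coordinates `b` is `f'(|y|) / |y| * ½ ∂_ξ g(b, b)`, which is also its
vertical derivative along `Γ(ξ, y)`. -/
theorem horizontalGrad_radial
    (hF : ∀ (x : M) (y : TangentSpace 𝓘(ℝ, E) x), r ≤ ‖y‖ → F ⟨x, y⟩ = h ‖y‖)
    (hr : 0 ≤ r) (hy : r < ‖y‖) (hh : HasDerivAt h h' ‖y‖) :
    horizontalGrad F ⟨x, y⟩ = 0 := by
  have hypos : 0 < ‖y‖ := hr.trans_lt hy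
  have hs : x ∈ (chartAt E x).source := mem_chart_source E x
  have hd : DifferentiableAt ℝ (localMetric x) (extChartAt 𝓘(ℝ, E) x x) :=
    differentiableAt_localMetric x
  set b := toCoord x x y with hb
  have hnorm : ∀ x' ∈ (chartAt E x).source,
      ‖ofCoord x x' b‖ = √(localMetric x (extChartAt 𝓘(ℝ, E) x x') b b) := by
    intro x' hx'
    rw [norm_eq_sqrt_real_inner, inner_eq_localMetric hx', toCoord_ofCoord hx']
  have hnorm₀ : ‖y‖ = √(localMetric x (extChartAt 𝓘(ℝ, E) x x) b b) := by
    rw [← hnorm x hs, ofCoord_toCoord hs]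
  have hpos : localMetric x (extChartAt 𝓘(ℝ, E) x x) b b ≠ 0 := fun h0 => by
    rw [h0, Real.sqrt_zero] at hnorm₀
    exact hypos.ne' hnorm₀
  have h1 := (hasFDerivAt_localMetric_apply hd b b).sqrt hpos
  have hh₀ := hh
  rw [hnorm₀] at hh₀
  have h2 : HasFDerivAt (fun p => h (√(localMetric x p b b))) _ (extChartAt 𝓘(ℝ, E) x x) :=
    hh₀.comp_hasFDerivAt (extChartAt 𝓘(ℝ, E) x x) h1
  have h3 : MDifferentiableAt 𝓘(ℝ, E) 𝓘(ℝ, E) (extChartAt 𝓘(ℝ, E) x) x :=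
    mdifferentiableAt_extChartAt hs
  have h4 := h2.hasMFDerivAt.comp x h3.hasMFDerivAt
  have hc : ContinuousAt (fun x' => √(localMetric x (extChartAt 𝓘(ℝ, E) x x') b b)) x :=
    ContinuousAt.comp (g := fun p => √(localMetric x p b b)) h1.continuousAt
      (continuousAt_extChartAt x)
  have hev : (fun x' : M => F ⟨x', ofCoord x x' b⟩) =ᶠ[𝓝 x]
      fun x' => h (√(localMetric x (extChartAt 𝓘(ℝ, E) x x') b b)) := by
    filter_upwards [hc.eventually_const_lt (hnorm₀ ▸ hy), chart_source_mem_nhds E x]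
      with x' h1 h2
    rw [hF, hnorm x' h2]
    rw [hnorm x' h2]
    exact h1.le
  have h5 := (h4.congr_of_eventuallyEq hev).mfderiv
  refine ext_inner_right ℝ fun c => ?_
  have h6 : mvfderiv 𝓘(ℝ, E) (fun x' : M => F ⟨x', ofCoord x x' b⟩) x c =
      h' / ‖y‖ * (1 / 2 * metricDeriv x (toCoord x x c) b b) := by
    rw [hnorm₀, toCoord_eq_mfderiv hs]
    let ξ : E := mfderiv 𝓘(ℝ, E) 𝓘(ℝ, E) (extChartAt 𝓘(ℝ, E) x) x c
    have h7 := DFunLike.congr_fun h5 c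
    refine h7.trans ?_
    change h' * (1 / (2 * √(localMetric x (extChartAt 𝓘(ℝ, E) x x) b b)) *
      metricDeriv x ξ b b) = h' / √(localMetric x (extChartAt 𝓘(ℝ, E) x x) b b) *
      (1 / 2 * metricDeriv x ξ b b)
    ring
  have h7 : verticalDeriv F ⟨x, y⟩ (christoffel x c y) =
      h' / ‖y‖ * (1 / 2 * metricDeriv x (toCoord x x c) b b) := by
    rw [verticalDeriv_radial (hF x) hr hy hh, real_inner_comm, inner_christoffel]
    ring
  rw [horizontalGrad, inner_sharp, inner_zero_left]
  exact sub_eq_zero.2 (h6.trans h7.symm)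

end Radial

end FloerBound

/-! ### The Floer equation outside the disc bundle of radius `r` -/

namespace FloerBound

theorem IsC1Family.hasDerivAt {r : ℝ} {f : ℝ → ℝ → ℝ} (hf : IsC1Family r f) (s : ℝ) {ρ : ℝ}
    (hρ : r < ρ) : HasDerivAt (f s) (derivWithin (f s) (Ici r) ρ) ρ :=
  (((hf.smooth s).differentiableOn (by simp)) ρ hρ.le).hasDerivWithinAt.hasDerivAt
    (Ici_mem_nhds hρ)

/-- The chain rule for `σ ↦ f_σ'(ϱ(σ))`, where `f_σ'` varies both with the parameter and with its
argument. -/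
theorem IsC1Family.hasDerivAt_derivWithin_comp {r : ℝ} {f : ℝ → ℝ → ℝ} (hf : IsC1Family r f)
    {ϱ : ℝ → ℝ} {ϱ' s : ℝ} (hρ : r < ϱ s) (hϱ : HasDerivAt ϱ ϱ' s) :
    HasDerivAt (fun σ => derivWithin (f σ) (Ici r) (ϱ σ))
      (deriv (fun σ => derivWithin (f σ) (Ici r) (ϱ s)) s
        + iteratedDerivWithin 2 (f s) (Ici r) (ϱ s) * ϱ') s := by
  have hG := hf.c1 1
  simp only [iteratedDerivWithin_one] at hG
  have hd : HasFDerivAt (fun q : ℝ × ℝ => derivWithin (f q.1) (Ici r) q.2) _ (s, ϱ s) :=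
    ((hG.contDiffAt (prod_mem_nhds univ_mem (Ici_mem_nhds hρ))).differentiableAt
      one_ne_zero).hasFDerivAt
  set L := fderiv ℝ (fun q : ℝ × ℝ => derivWithin (f q.1) (Ici r) q.2) (s, ϱ s)
  have h1 : HasDerivAt (fun σ => derivWithin (f σ) (Ici r) (ϱ s)) (L (1, 0)) s :=
    HasFDerivAt.comp_hasDerivAt (f := fun σ => (σ, ϱ s)) s hd
      ((hasDerivAt_id s).prodMk (hasDerivAt_const s _))
  have h2 : HasDerivAt (derivWithin (f s) (Ici r)) (L (0, 1)) (ϱ s) :=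
    HasFDerivAt.comp_hasDerivAt (f := fun ρ => (s, ρ)) (ϱ s) hd
      ((hasDerivAt_const _ s).prodMk (hasDerivAt_id _))
  have h3 : HasDerivAt (fun σ => derivWithin (f σ) (Ici r) (ϱ σ)) (L (1, ϱ')) s :=
    HasFDerivAt.comp_hasDerivAt (f := fun σ => (σ, ϱ σ)) s hd ((hasDerivAt_id s).prodMk hϱ)
  have h4 : iteratedDerivWithin 2 (f s) (Ici r) (ϱ s) = L (0, 1) := by
    rw [iteratedDerivWithin_succ, iteratedDerivWithin_one]
    exact h2.hasDerivWithinAt.derivWithin (uniqueDiffOn_Ici r _ hρ.le)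
  rw [h1.deriv, h4]
  refine h3.congr_deriv ?_
  have : ((1, ϱ') : ℝ × ℝ) = (1, 0) + ϱ' • (0, 1) := by simp
  rw [this, map_add, map_smul, smul_eq_mul, mul_comm]

section Floer

variable {E : Type*} [NormedAddCommGroup E] [NormedSpace ℝ E] [FiniteDimensional ℝ E]
  {M : Type*} [TopologicalSpace M] [ChartedSpace E M] [IsManifold 𝓘(ℝ, E) ∞ M]
  [RiemannianBundle (fun x : M => TangentSpace 𝓘(ℝ, E) x)]
  [IsContMDiffRiemannianBundle 𝓘(ℝ, E) ∞ E (fun x : M => TangentSpace 𝓘(ℝ, E) x)]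

theorem hasDerivAt_half_norm_sq {z : ℝ → TangentBundle 𝓘(ℝ, E) M}
    (hz : ContMDiff 𝓘(ℝ, ℝ) 𝓘(ℝ, E).tangent ∞ z) (τ : ℝ) :
    HasDerivAt (fun σ => ‖(z σ).2‖ ^ 2 / 2) (inner ℝ (covDeriv z τ) (z τ).2) τ := by
  have h := hasDerivAt_inner (γ := fun σ => (z σ).proj) (a := fun σ => (z σ).2)
    (b := fun σ => (z σ).2) (mdifferentiableAt_proj (hz τ)) (differentiableAt_toCoord (hz τ))
    (differentiableAt_toCoord (hz τ))
  simp only [real_inner_self_eq_norm_sq] at h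
  refine (h.div_const 2).congr_deriv ?_
  rw [real_inner_comm (covDeriv _ τ)]
  exact add_self_div_two _

theorem hasDerivAt_norm {z : ℝ → TangentBundle 𝓘(ℝ, E) M}
    (hz : ContMDiff 𝓘(ℝ, ℝ) 𝓘(ℝ, E).tangent ∞ z) {τ : ℝ} (h0 : 0 < ‖(z τ).2‖) :
    HasDerivAt (fun σ => ‖(z σ).2‖) (inner ℝ (covDeriv z τ) (z τ).2 / ‖(z τ).2‖) τ := by
  have h := ((hasDerivAt_half_norm_sq hz τ).const_mul 2).sqrt (by positivity)
  simp only [mul_div_cancel₀ _ (two_ne_zero' ℝ), Real.sqrt_sq (norm_nonneg _)] at h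
  refine h.congr_deriv ?_
  field_simp

theorem continuous_norm_snd {w : ℝ → ℝ → TangentBundle 𝓘(ℝ, E) M}
    (hw : ContMDiff 𝓘(ℝ, ℝ × ℝ) 𝓘(ℝ, E).tangent ∞ (fun q : ℝ × ℝ => w q.1 q.2)) :
    Continuous fun q : ℝ × ℝ => ‖(w q.1 q.2).2‖ := by
  have h : ContMDiff 𝓘(ℝ, ℝ × ℝ) 𝓘(ℝ, ℝ) ∞
      (fun q : ℝ × ℝ => inner ℝ (w q.1 q.2).2 (w q.1 q.2).2) :=
    ContMDiff.inner_bundle (E := fun x : M => TangentSpace 𝓘(ℝ, E) x)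
      (b := fun q : ℝ × ℝ => (w q.1 q.2).proj) hw hw
  simp only [norm_eq_sqrt_real_inner]
  exact h.continuous.sqrt

/-- Where `|v| > r`, the horizontal gradient vanishes and the vertical one is radial, so that the
Floer equation reads `∂_s u = ∇_t v`, `∂_t u = f_s'(|v|) v / |v| - ∇_s v`. -/
theorem SolvesFloer.radial {r : ℝ} (hr : 0 ≤ r) {f : ℝ → ℝ → ℝ} (hf : IsC1Family r f)
    {H : ℝ → ℝ → TangentBundle 𝓘(ℝ, E) M → ℝ}
    (hHrad : ∀ (s t : ℝ) (x : M) (y : TangentSpace 𝓘(ℝ, E) x), r ≤ ‖y‖ → H s t ⟨x, y⟩ = f s ‖y‖)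
    {w : ℝ → ℝ → TangentBundle 𝓘(ℝ, E) M} (hFloer : SolvesFloer H w) {s t : ℝ}
    (hv : r < ‖(w s t).2‖) :
    velocity (fun σ => (w σ t).proj) s = covDeriv (fun τ => w s τ) t ∧
    velocity (fun τ => (w s τ).proj) t =
      (derivWithin (f s) (Ici r) ‖(w s t).2‖ / ‖(w s t).2‖) • (w s t).2
        - covDeriv (fun σ => w σ t) s := by
  obtain ⟨h1, h2⟩ := hFloer s t
  have h3 : horizontalGrad (H s t) (w s t) = 0 :=
    horizontalGrad_radial (hHrad s t) hr hv (hf.hasDerivAt s hv)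
  have h4 : verticalGrad (H s t) (w s t) = _ :=
    verticalGrad_radial (hHrad s t _) hr hv (hf.hasDerivAt s hv)
  rw [h3] at h1
  rw [h4] at h2
  exact ⟨sub_eq_zero.1 h1, eq_sub_of_add_eq' h2⟩

/-- Where `|v| > r`, the function `φ = |v|² / 2` satisfies `Δφ ≥ f_s''(|v|) ∂_s φ`. The functions
`a`, `b` are `∂_s φ`, `∂_t φ`, and `a'`, `b'` the second derivatives. Since
`∂_s φ = f_s'(|v|) |v| - ⟨∂_t u, v⟩` and `∂_t φ = ⟨∂_s u, v⟩` hold near the point, the second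
derivatives are obtained from metric compatibility at the point alone, and the terms with
`∇_s ∂_t u = ∇_t ∂_s u` cancel in their sum. -/
theorem exists_subsolution_derivs {r : ℝ} (hr : 0 ≤ r) {f : ℝ → ℝ → ℝ} (hf : IsC1Family r f)
    (hmono : ∀ s : ℝ, ∀ ρ ∈ Ici r, 0 ≤ deriv (fun σ => derivWithin (f σ) (Ici r) ρ) s)
    {H : ℝ → ℝ → TangentBundle 𝓘(ℝ, E) M → ℝ}
    (hHrad : ∀ (s t : ℝ) (x : M) (y : TangentSpace 𝓘(ℝ, E) x), r ≤ ‖y‖ → H s t ⟨x, y⟩ = f s ‖y‖)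
    {w : ℝ → ℝ → TangentBundle 𝓘(ℝ, E) M}
    (hw : ContMDiff 𝓘(ℝ, ℝ × ℝ) 𝓘(ℝ, E).tangent ∞ (fun q : ℝ × ℝ => w q.1 q.2))
    (hFloer : SolvesFloer H w) {s t : ℝ} (hv : r < ‖(w s t).2‖) :
    ∃ (a b : ℝ → ℝ) (a' b' : ℝ),
      (∀ᶠ σ in 𝓝 s, HasDerivAt (fun σ => ‖(w σ t).2‖ ^ 2 / 2) (a σ) σ) ∧ HasDerivAt a a' s ∧
      (∀ᶠ τ in 𝓝 t, HasDerivAt (fun τ => ‖(w s τ).2‖ ^ 2 / 2) (b τ) τ) ∧ HasDerivAt b b' t ∧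
      iteratedDerivWithin 2 (f s) (Ici r) ‖(w s t).2‖ * a s ≤ a' + b' := by
  have hwt : ∀ t, ContMDiff 𝓘(ℝ, ℝ) 𝓘(ℝ, E).tangent ∞ (fun σ => w σ t) := fun t =>
    hw.comp (contDiff_id.prodMk contDiff_const).contMDiff
  have hws : ∀ s, ContMDiff 𝓘(ℝ, ℝ) 𝓘(ℝ, E).tangent ∞ (fun τ => w s τ) := fun s =>
    hw.comp (contDiff_const.prodMk contDiff_id).contMDiff
  have hu : ContMDiff 𝓘(ℝ, ℝ × ℝ) 𝓘(ℝ, E) ∞ (fun q : ℝ × ℝ => (w q.1 q.2).proj) :=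
    (contMDiff_proj _).comp hw
  have hcont := continuous_norm_snd hw
  have hevs : ∀ᶠ σ in 𝓝 s, r < ‖(w σ t).2‖ :=
    (hcont.comp (by fun_prop : Continuous fun σ : ℝ => (σ, t))).continuousAt.eventually_const_lt hv
  have hevt : ∀ᶠ τ in 𝓝 t, r < ‖(w s τ).2‖ :=
    (hcont.comp (by fun_prop : Continuous fun τ : ℝ => (s, τ))).continuousAt.eventually_const_lt hv
  have hρ : 0 < ‖(w s t).2‖ := hr.trans_lt hv
  -- the derivative in `s` in terms of `∂_t u`, and the derivative in `t` in terms of `∂_s u`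
  have ha : ∀ σ, r < ‖(w σ t).2‖ → HasDerivAt (fun σ => ‖(w σ t).2‖ ^ 2 / 2)
      (derivWithin (f σ) (Ici r) ‖(w σ t).2‖ * ‖(w σ t).2‖
        - inner ℝ (velocity (fun τ => (w σ τ).proj) t) (w σ t).2) σ := by
    intro σ hσ
    refine (hasDerivAt_half_norm_sq (hwt t) σ).congr_deriv ?_
    have := (hr.trans_lt hσ).ne'
    rw [(hFloer.radial hr hf hHrad hσ).2, inner_sub_left, real_inner_smul_left,
      real_inner_self_eq_norm_sq]
    field_simp
    ring
  have hb : ∀ τ, r < ‖(w s τ).2‖ → HasDerivAt (fun τ => ‖(w s τ).2‖ ^ 2 / 2)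
      (inner ℝ (velocity (fun σ => (w σ τ).proj) s) (w s τ).2) τ := by
    intro τ hτ
    rw [(hFloer.radial hr hf hHrad hτ).1]
    exact hasDerivAt_half_norm_sq (hws s) τ
  have h1 := hasDerivAt_inner (γ := fun σ => (w σ t).proj)
    (a := fun σ => velocity (fun τ => (w σ τ).proj) t) (b := fun σ => (w σ t).2)
    (mdifferentiableAt_proj (hwt t s)) (hasDerivAt_toCoord_velocity_snd hu s t).differentiableAt
    (differentiableAt_toCoord (hwt t s))
  have h2 := hasDerivAt_inner (γ := fun τ => (w s τ).proj)
    (a := fun τ => velocity (fun σ => (w σ τ).proj) s) (b := fun τ => (w s τ).2)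
    (mdifferentiableAt_proj (hws s t)) (hasDerivAt_toCoord_velocity_fst hu s t).differentiableAt
    (differentiableAt_toCoord (hws s t))
  have h3 := hasDerivAt_norm (hwt t) hρ
  have h4 := ((hf.hasDerivAt_derivWithin_comp (ϱ := fun σ => ‖(w σ t).2‖) hv h3).mul h3).sub h1
  refine ⟨_, _, _, _, hevs.mono ha, h4, hevt.mono hb, h2, ?_⟩
  -- the terms `⟨∇_s ∂_t u, v⟩` cancel because the connection is torsion free
  obtain ⟨hF1, hF2⟩ := hFloer.radial hr hf hHrad hv
  have hm := mul_nonneg (hmono s _ hv.le) hρ.le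
  rw [covDeriv_velocity_comm hu s t, hF1, hF2]
  set N := covDeriv (fun σ => w σ t) s with hN
  set Y := covDeriv (fun τ => w s τ) t with hY
  change _ ≤ _ - (_ + inner ℝ _ N) + (_ + inner ℝ _ Y)
  simp only [inner_sub_left, real_inner_smul_left, real_inner_self_eq_norm_sq]
  rw [real_inner_comm N (w s t).2]
  -- the difference of the two sides is `|∇_s v|² + |∇_t v|² + |v| ∂_s f_s'(|v|)`
  refine sub_nonneg.1 (le_of_le_of_eq
    (add_nonneg (add_nonneg (sq_nonneg ‖N‖) (sq_nonneg ‖Y‖)) hm) ?_)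
  field_simp
  ring

end Floer

end FloerBound

theorem mainTheorem8
    {E : Type*} [NormedAddCommGroup E] [NormedSpace ℝ E] [FiniteDimensional ℝ E]
    {M : Type*} [TopologicalSpace M] [T2Space M] [CompactSpace M] [ConnectedSpace M]
    [ChartedSpace E M] [IsManifold 𝓘(ℝ, E) ∞ M]
    [RiemannianBundle (fun x : M => TangentSpace 𝓘(ℝ, E) x)]
    [IsContMDiffRiemannianBundle 𝓘(ℝ, E) ∞ E (fun x : M => TangentSpace 𝓘(ℝ, E) x)]
    (r c : ℝ) (hr : 0 ≤ r) (hc : 0 ≤ c)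
    (f : ℝ → ℝ → ℝ) (hf : FloerBound.IsC1Family r f)
    (hmono : ∀ s : ℝ, ∀ ρ ∈ Ici r, 0 ≤ deriv (fun σ => derivWithin (f σ) (Ici r) ρ) s)
    (hconv : (∀ s : ℝ, ∀ ρ ∈ Ici r, -c ≤ iteratedDerivWithin 2 (f s) (Ici r) ρ) ∨
      (∀ s : ℝ, ∀ ρ ∈ Ici r, iteratedDerivWithin 2 (f s) (Ici r) ρ ≤ c))
    (H : ℝ → ℝ → TangentBundle 𝓘(ℝ, E) M → ℝ)
    (hH : ContMDiff (𝓘(ℝ, ℝ × ℝ).prod 𝓘(ℝ, E).tangent) 𝓘(ℝ, ℝ) ∞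
      (fun q : (ℝ × ℝ) × TangentBundle 𝓘(ℝ, E) M => H q.1.1 q.1.2 q.2))
    (hHper : ∀ s t z, H s (t + 1) z = H s t z)
    (hHrad : ∀ (s t : ℝ) (x : M) (y : TangentSpace 𝓘(ℝ, E) x), r ≤ ‖y‖ → H s t ⟨x, y⟩ = f s ‖y‖)
    (w : ℝ → ℝ → TangentBundle 𝓘(ℝ, E) M)
    (hw : ContMDiff 𝓘(ℝ, ℝ × ℝ) 𝓘(ℝ, E).tangent ∞ (fun q : ℝ × ℝ => w q.1 q.2))
    (hwper : ∀ s t, w s (t + 1) = w s t)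
    (hFloer : FloerBound.SolvesFloer H w)
    (hends : ∃ T : ℝ, 0 < T ∧ ∀ s t : ℝ, T ≤ |s| → ‖(w s t).2‖ ≤ r) :
    ∀ s t : ℝ, ‖(w s t).2‖ ≤ r := by
  have hiff : ∀ s t : ℝ, r ^ 2 / 2 < ‖(w s t).2‖ ^ 2 / 2 ↔ r < ‖(w s t).2‖ := fun s t => by
    rw [div_lt_div_iff_of_pos_right two_pos, sq_lt_sq₀ hr (norm_nonneg _)]
  obtain ⟨T, -, hT⟩ := hends
  -- a single exponent `l` covers both one-sided bounds on the second derivatives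
  obtain ⟨l, hl⟩ : ∃ l : ℝ, ∀ s : ℝ, ∀ ρ ∈ Ici r,
      iteratedDerivWithin 2 (f s) (Ici r) ρ * l < l ^ 2 := by
    rcases hconv with h | h
    · exact ⟨-(c + 1), fun s ρ hρ => by nlinarith [h s ρ hρ]⟩
    · exact ⟨c + 1, fun s ρ hρ => by nlinarith [h s ρ hρ]⟩
  intro s t
  refine not_lt.1 fun hst => not_lt.2 ?_ ((hiff s t).2 hst)
  refine cylinder_maximum_principle (φ := fun s t => ‖(w s t).2‖ ^ 2 / 2)
    (k := fun s t => iteratedDerivWithin 2 (f s) (Ici r) ‖(w s t).2‖) (T := T) (l := l)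
    (((FloerBound.continuous_norm_snd hw).pow 2).div_const 2)
    (fun s t => congrArg (fun z : TangentBundle 𝓘(ℝ, E) M => ‖z.2‖ ^ 2 / 2) (hwper s t))
    (fun s t h => ?_) (fun s t h => ?_) (fun s t h => ?_) s t
  · exact not_lt.1 fun h' => ((hiff s t).1 h').not_ge (hT s t h)
  · exact hl s _ ((hiff s t).1 h).le
  · exact FloerBound.exists_subsolution_derivs hr hf hmono hHrad hw hFloer ((hiff s t).1 h)
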